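/- **Theorem 1.** An $n$-qubit state is a positive semidefinite matrix $\sigma\in\mathbb C^{2^n\times 2^n}$ with $\operatorname{tr}\sigma=1$, and $\mathcal P_n=\{I,X,Y,Z\}^{\otimes n}$ is the set of $n$-qubit Pauli strings. A two-copy measurement is a POVM $\{F_s\}_s$ on $2n$ qubits ($F_s\succeq 0$, $\sum_s F_s=I$); applied to $\sigma\otimes\sigma$ it consumes two copies of $\sigma$ and returns $s$ with probability $\operatorname{tr}(F_s(\sigma\otimes\sigma))$. A (possibly randomized) protocol draws a random seed from a discrete distribution, makes a fixed number $T$ of two-copy measurements, each on two fresh copies of $\sigma$ (so it uses $2T$ copies), where the measurement in each round may depend on the seed and on the outcomes of the earlier rounds, and finally outputs, from the seed and all outcomes, real numbers $(e_P)_{P\in\mathcal P_n}$. It is nonadaptive if no measurement depends on earlier outcomes. For $\varepsilon>0$ and $\delta>0$, it solves Pauli shadow tomography with error less than $\varepsilon$ and failure probability $\delta$ if for every $n$-qubit state $\sigma$, with probability at least $1-\delta$, $|e_P-\operatorname{tr}(P\sigma)|<\varepsilon$ holds for all $P\in\mathcal P_n$ simultaneously. 1. (Nonadaptive lower bound.)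 For every $0<\delta<\tfrac12$ there is a constant $c>0$ such that for all $n\ge 1$, every nonadaptive protocol that solves Pauli shadow tomography on $n$ qubits with error less than $1$ and failure probability $\delta$ uses at least $c\,2^{n/2}$ copies of $\sigma$. 2. (Adaptive upper bound.) For every $\varepsilon>0$ and $\delta>0$ there is a constant $C>0$ such that for all $n\ge 1$ there is a protocol with adaptively chosen two-copy measurements that solves Pauli shadow tomography on $n$ qubits with error less than $\varepsilon$ and failure probability $\delta$ and uses at most $C\,n$ copies of $\sigma$. In particular this holds for error less than $1$. -/

import Mathlib

open scoped ENNReal ComplexOrder Kronecker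

noncomputable section

namespace PauliShadow

/-- Labels of the computational basis of `n` qubits. -/
abbrev Qubits (n : ℕ) : Type := Fin n → Fin 2

/-- Labels of the single-qubit Pauli matrices. -/
inductive Pauli : Type
  | I
  | X
  | Y
  | Z

/-- The single-qubit Pauli matrices. -/
def Pauli.toMatrix : Pauli → Matrix (Fin 2) (Fin 2) ℂ
  | .I => !![1, 0; 0, 1]
  | .X => !![0, 1; 1, 0]
  | .Y => !![0, -Complex.I; Complex.I, 0]
  | .Z => !![1, 0; 0, -1]

/-- An `n`-qubit Pauli string, given by one letter for each qubit. -/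
abbrev PauliString (n : ℕ) : Type := Fin n → Pauli

/-- The matrix `P₁ ⊗ ⋯ ⊗ Pₙ` of a Pauli string. -/
def PauliString.toMatrix {n : ℕ} (P : PauliString n) : Matrix (Qubits n) (Qubits n) ℂ :=
  Matrix.of fun x y => ∏ i, (P i).toMatrix (x i) (y i)

/-- `σ` is the density matrix of an `n`-qubit state. -/
def IsState {n : ℕ} (σ : Matrix (Qubits n) (Qubits n) ℂ) : Prop :=
  σ.PosSemidef ∧ σ.trace = 1

/-- A two-copy measurement with outcomes in `Ω` (finite or infinite): a POVM on `2n` qubits. -/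
structure TwoCopyPOVM (n : ℕ) (Ω : Type) where
  /-- The POVM element of each outcome. -/
  elem : Ω → Matrix (Qubits n × Qubits n) (Qubits n × Qubits n) ℂ
  posSemidef : ∀ s, (elem s).PosSemidef
  hasSum_one : HasSum elem 1

/-- The Born probability `tr(F_s (σ ⊗ σ))` of outcome `s` when two copies of `σ` are measured. -/
def TwoCopyPOVM.prob {n : ℕ} {Ω : Type} (M : TwoCopyPOVM n Ω)
    (σ : Matrix (Qubits n) (Qubits n) ℂ) (s : Ω) : ℝ :=
  (M.elem s * (σ ⊗ₖ σ)).trace.re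

/-- A (possibly randomized) protocol that makes adaptively chosen two-copy measurements, each on
two fresh copies of the unknown `n`-qubit state, and then estimates every Pauli expectation. -/
structure Protocol (n : ℕ) where
  /-- Values of the internal randomness, which is drawn before the first measurement. -/
  Seed : Type
  seedDist : PMF Seed
  /-- Measurement outcomes. -/
  Outcome : Type
  /-- The number of two-copy measurements. -/
  rounds : ℕ
  /-- The measurement made in round `t`, given the seed and the outcomes of the earlier rounds. -/
  measurement : Seed → (t : Fin rounds) → (Fin t → Outcome) → TwoCopyPOVM n Outcome
  /-- The estimates computed from the seed and all the outcomes. -/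
  estimate : Seed → (Fin rounds → Outcome) → PauliString n → ℝ

namespace Protocol

variable {n : ℕ} (A : Protocol n)

/-- The number of copies of the unknown state that are consumed. -/
def copies : ℕ := 2 * A.rounds

/-- A protocol is nonadaptive if the measurements do not depend on earlier outcomes: they are all
fixed (by the seed) ahead of time. -/
def IsNonadaptive : Prop :=
  ∀ (r : A.Seed) (t : Fin A.rounds) (h h' : Fin t → A.Outcome),
    A.measurement r t h = A.measurement r t h'

/-- The probability of the outcome sequence `s`, given the seed `r`, on copies of `σ`. -/
def transcriptProb (σ : Matrix (Qubits n) (Qubits n) ℂ) (r : A.Seed)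
    (s : Fin A.rounds → A.Outcome) : ℝ≥0∞ :=
  ∏ t : Fin A.rounds, ENNReal.ofReal
    ((A.measurement r t fun i => s (Fin.castLE t.isLt.le i)).prob σ (s t))

/-- All the estimates are within additive error less than `ε` of the true values `tr(Pσ)`. -/
def IsGood (σ : Matrix (Qubits n) (Qubits n) ℂ) (ε : ℝ) (r : A.Seed)
    (s : Fin A.rounds → A.Outcome) : Prop :=
  ∀ P : PauliString n, ‖(A.estimate r s P : ℂ) - (P.toMatrix * σ).trace‖ < ε

open Classical in
/-- The probability that all the estimates have additive error less than `ε`. -/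
def successProb (σ : Matrix (Qubits n) (Qubits n) ℂ) (ε : ℝ) : ℝ≥0∞ :=
  ∑' r : A.Seed, A.seedDist r *
    ∑' s : Fin A.rounds → A.Outcome, if A.IsGood σ ε r s then A.transcriptProb σ r s else 0

/-- For every `n`-qubit state, with probability at least `1 - δ`, the protocol estimates all the
Pauli expectations simultaneously to additive error less than `ε`. -/
def Solves (ε δ : ℝ) : Prop :=
  ∀ σ : Matrix (Qubits n) (Qubits n) ℂ, IsState σ → ENNReal.ofReal (1 - δ) ≤ A.successProb σ ε

end Protocol

end PauliShadow

end

namespace PauliShadow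

open Finset Matrix

/-! Lower bound. An estimate of `tr(Pσ)` with error below 1 tells `2⁻ⁿ(I + P)` from `2⁻ⁿ(I - P)`. On
two copies the `P ⊗ P` terms of these states agree, so they differ by `2·4⁻ⁿ(P ⊗ I + I ⊗ P)`, and a
POVM element sees `P` only through its two partial traces (`prob_pauliState_sub`). Parseval and
Cauchy–Schwarz over the `4ⁿ` strings (`sum_norm_trace_mul_le`) bound the total variation distance,
summed over `P`, by `4·2ⁿ·2^(n/2)` per measurement: about `2^(-n/2)` on average. Nonadaptive
measurements are independent of `P` given the seed and yield product distributions, so these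
distances add up over the rounds (`tsum_prod_sub_prod_le`), forcing order `2^(n/2)` rounds.

Upper bound. The Bell basis diagonalizes all `P ⊗ P` at once with eigenvalues `±1`, so a Chernoff
and a union bound over `4ⁿ` strings give every `tr(Pσ)²` from `O(n)` Bell measurements of `σ ⊗ σ`.
For the signs, take any state `ρ` whose squared expectations fit this data; `σ` itself shows that
one exists. Bell measurements of `σ ⊗ ρ` then estimate all `tr(Pρ) tr(Pσ)`, and dividing by the
known `tr(Pρ)` recovers `tr(Pσ)`, unless `tr(Pρ)` is small, in which case 0 is a good estimate.
Adaptivity is needed once, to choose `ρ`. -/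

/-! ### Pauli strings and Bell signs -/

instance : Fintype Pauli :=
  ⟨⟨([.I, .X, .Y, .Z] : List Pauli), by simp⟩, by rintro (_ | _ | _ | _) <;> simp⟩

theorem Pauli.sum_univ {M : Type*} [AddCommMonoid M] (f : Pauli → M) :
    ∑ Q, f Q = f .I + (f .X + (f .Y + f .Z)) := by
  change (Multiset.map f (([.I, .X, .Y, .Z] : List Pauli) : Multiset Pauli)).sum = _
  simp

theorem Pauli.card_eq : Fintype.card Pauli = 4 := rfl

/-- The eigenvalue of `P ⊗ P` on the Bell state with label `Q`. -/
def Pauli.bellSign : Pauli → Pauli → ℝ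
  | .I, _ => 1
  | .X, .I => 1
  | .X, .X => 1
  | .X, _ => -1
  | .Y, .X => 1
  | .Y, .Z => 1
  | .Y, _ => -1
  | .Z, .I => 1
  | .Z, .Z => 1
  | .Z, _ => -1

theorem Pauli.abs_bellSign (P Q : Pauli) : |P.bellSign Q| = 1 := by
  cases P <;> cases Q <;> simp [Pauli.bellSign]

/-- Spectral decomposition of `P ⊗ P`: it maps the vectorization of `Q` to that of `P Q Pᵀ = ±Q`, a
vector of squared norm 2. As `Yᵀ = -Y`, the signs for `Y` are the commutation signs reversed. -/
theorem Pauli.sum_bellSign (P : Pauli) (a b c d : Fin 2) :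
    ∑ Q : Pauli, (P.bellSign Q : ℂ) * (Q.toMatrix a b * star (Q.toMatrix c d)) =
      2 * (P.toMatrix a c * P.toMatrix b d) := by
  rw [Pauli.sum_univ]
  cases P <;> fin_cases a <;> fin_cases b <;> fin_cases c <;> fin_cases d <;>
    simp [Pauli.bellSign, Pauli.toMatrix] <;> norm_num

theorem Pauli.star_toMatrix (P : Pauli) (a b : Fin 2) :
    star (P.toMatrix a b) = P.toMatrix b a := by
  cases P <;> fin_cases a <;> fin_cases b <;> simp [Pauli.toMatrix]

theorem Pauli.toMatrix_mul_self (P : Pauli) : P.toMatrix * P.toMatrix = 1 := by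
  cases P <;> ext a b <;> fin_cases a <;> fin_cases b <;>
    simp [Pauli.toMatrix]

theorem Pauli.trace_toMatrix {P : Pauli} (h : P ≠ .I) : P.toMatrix.trace = 0 := by
  cases P <;> simp_all [Pauli.toMatrix, Matrix.trace]

variable {n : ℕ}

namespace PauliString

/-- The eigenvalue of `P ⊗ P` on the Bell state with label `Q`. -/
def bellSign (P Q : PauliString n) : ℝ := ∏ i, (P i).bellSign (Q i)

theorem abs_bellSign (P Q : PauliString n) : |P.bellSign Q| = 1 := by
  simp [bellSign, Finset.abs_prod, Pauli.abs_bellSign]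

/-- The one-qubit identities multiply. Completeness of the Pauli basis and both Bell measurements
below rest on this. -/
theorem sum_bellSign (P : PauliString n) (a b c d : Qubits n) :
    ∑ Q : PauliString n, (P.bellSign Q : ℂ) * (Q.toMatrix a b * star (Q.toMatrix c d)) =
      2 ^ n * (P.toMatrix a c * P.toMatrix b d) := by
  have h := Fintype.prod_sum (fun (i : Fin n) (Q : Pauli) =>
    ((P i).bellSign Q : ℂ) * (Q.toMatrix (a i) (b i) * star (Q.toMatrix (c i) (d i))))
  simp only [Pauli.sum_bellSign, Finset.prod_mul_distrib] at h
  simp only [bellSign, toMatrix, Matrix.of_apply, star_prod, Complex.ofReal_prod]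
  rw [← h]
  simp

theorem toMatrix_I : toMatrix (fun _ : Fin n => Pauli.I) = 1 := by
  have h : Pauli.I.toMatrix = 1 := by
    ext a b; fin_cases a <;> fin_cases b <;> simp [Pauli.toMatrix]
  ext a b
  simp only [toMatrix, h, Matrix.of_apply, Matrix.one_apply]
  simp [Finset.prod_ite_zero, funext_iff]

theorem bellSign_I (Q : PauliString n) : bellSign (fun _ => Pauli.I) Q = 1 := by
  simp [bellSign, Pauli.bellSign]

/-- The Pauli strings form an orthogonal basis, in the form of a completeness relation. -/
theorem sum_mul_star (a b c d : Qubits n) :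
    ∑ Q : PauliString n, Q.toMatrix a b * star (Q.toMatrix c d) =
      2 ^ n * ((1 : Matrix (Qubits n) (Qubits n) ℂ) a c * (1 : Matrix _ _ ℂ) b d) := by
  simpa [bellSign_I, toMatrix_I] using sum_bellSign (fun _ : Fin n => Pauli.I) a b c d

theorem isHermitian (P : PauliString n) : P.toMatrix.IsHermitian := by
  ext a b
  simp only [toMatrix, conjTranspose_apply, Matrix.of_apply, star_prod, Pauli.star_toMatrix]

theorem mul_self (P : PauliString n) : P.toMatrix * P.toMatrix = 1 := by
  ext a b
  have h := Fintype.prod_sum (fun (i : Fin n) (c : Fin 2) =>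
    (P i).toMatrix (a i) c * (P i).toMatrix c (b i))
  simp only [← Matrix.mul_apply, Pauli.toMatrix_mul_self] at h
  simp only [toMatrix, Matrix.mul_apply, Matrix.of_apply, ← Finset.prod_mul_distrib, ← h,
    Matrix.one_apply]
  simp [Finset.prod_ite_zero, funext_iff]

theorem trace_eq_zero {P : PauliString n} (hP : P ≠ fun _ => .I) : P.toMatrix.trace = 0 := by
  obtain ⟨i, hi⟩ : ∃ i, P i ≠ .I := by
    by_contra! h
    exact hP (funext h)
  have h := Fintype.prod_sum (fun (i : Fin n) (c : Fin 2) => (P i).toMatrix c c)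
  simp only [Matrix.trace, toMatrix, Matrix.diag_apply, Matrix.of_apply, ← h]
  exact Finset.prod_eq_zero (Finset.mem_univ i) (Pauli.trace_toMatrix hi)

end PauliString

/-! ### Trace inequalities, Born probabilities and Parseval -/

open scoped MatrixOrder Matrix.Norms.L2Operator in
theorem exists_eq_conjTranspose_mul_self {ι : Type*} [Fintype ι] {A : Matrix ι ι ℂ}
    (hA : A.PosSemidef) : ∃ B : Matrix ι ι ℂ, A = Bᴴ * B := by
  classical
  exact CStarAlgebra.nonneg_iff_eq_star_mul_self.mp hA.nonneg

/-- The trace of a product of positive semidefinite matrices is nonnegative. -/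
theorem trace_mul_re_nonneg {ι : Type*} [Fintype ι] {A B : Matrix ι ι ℂ}
    (hA : A.PosSemidef) (hB : B.PosSemidef) : 0 ≤ (A * B).trace.re := by
  obtain ⟨C, rfl⟩ := exists_eq_conjTranspose_mul_self hB
  rw [← Matrix.mul_assoc, Matrix.trace_mul_comm, ← Matrix.mul_assoc]
  exact (Complex.nonneg_iff.mp (hA.mul_mul_conjTranspose_same C).trace_nonneg).1

theorem IsState.prob_nonneg {σ : Matrix (Qubits n) (Qubits n) ℂ} (hσ : IsState σ) {Ω : Type}
    (M : TwoCopyPOVM n Ω) (s : Ω) : 0 ≤ M.prob σ s :=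
  trace_mul_re_nonneg (M.posSemidef s) (hσ.1.kronecker hσ.1)

theorem TwoCopyPOVM.hasSum_trace_mul {Ω : Type} (M : TwoCopyPOVM n Ω)
    (K : Matrix (Qubits n × Qubits n) (Qubits n × Qubits n) ℂ) :
    HasSum (fun s => (M.elem s * K).trace.re) K.trace.re := by
  have h := M.hasSum_one.map ((Complex.reAddGroupHom.comp (traceAddMonoidHom _ ℂ)).comp
    (AddMonoidHom.mulRight K)) (by
      change Continuous fun A : Matrix (Qubits n × Qubits n) (Qubits n × Qubits n) ℂ =>
        (A * K).trace.re
      fun_prop)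
  simpa [Function.comp_def] using h

theorem IsState.hasSum_prob {σ : Matrix (Qubits n) (Qubits n) ℂ} (hσ : IsState σ) {Ω : Type}
    (M : TwoCopyPOVM n Ω) : HasSum (M.prob σ) 1 := by
  have h := M.hasSum_trace_mul (σ ⊗ₖ σ)
  rw [trace_kronecker, hσ.2, mul_one, Complex.one_re] at h
  exact h

/-- With `A = Bᴴ * B` the entries are inner products of columns of `B`, and the trace is the sum of
their squared norms; Cauchy–Schwarz applies to each entry. -/
theorem sum_norm_sq_le_trace_sq {ι : Type*} [Fintype ι] {A : Matrix ι ι ℂ} (hA : A.PosSemidef) :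
    ∑ a, ∑ b, ‖A a b‖ ^ 2 ≤ A.trace.re ^ 2 := by
  obtain ⟨B, rfl⟩ := exists_eq_conjTranspose_mul_self hA
  have htr : (Bᴴ * B).trace.re = ∑ a, ∑ k, ‖B k a‖ ^ 2 := by
    simp [Matrix.trace, Matrix.mul_apply, Complex.sq_norm, Complex.normSq_apply]
  have hab (a b : ι) : ‖(Bᴴ * B) a b‖ ^ 2 ≤ (∑ k, ‖B k a‖ ^ 2) * ∑ k, ‖B k b‖ ^ 2 := by
    refine le_trans ?_ (Finset.sum_mul_sq_le_sq_mul_sq _ _ _)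
    gcongr
    rw [Matrix.mul_apply]
    exact (norm_sum_le _ _).trans_eq (by simp)
  calc _ ≤ ∑ a, ∑ b, (∑ k, ‖B k a‖ ^ 2) * ∑ k, ‖B k b‖ ^ 2 := by gcongr; exact hab _ _
    _ = _ := by rw [htr, sq, Finset.sum_mul_sum]

/-- Parseval's identity for the Pauli basis. -/
theorem sum_norm_trace_mul_sq (A : Matrix (Qubits n) (Qubits n) ℂ) :
    ∑ P : PauliString n, ‖(A * P.toMatrix).trace‖ ^ 2 = 2 ^ n * ∑ a, ∑ b, ‖A a b‖ ^ 2 := by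
  have htr (P : PauliString n) : (A * P.toMatrix).trace =
      ∑ p : Qubits n × Qubits n, A p.1 p.2 * P.toMatrix p.2 p.1 := by
    rw [Fintype.sum_prod_type]
    rfl
  have key : ∑ P : PauliString n, (A * P.toMatrix).trace * star (A * P.toMatrix).trace =
      2 ^ n * ∑ a, ∑ b, A a b * star (A a b) := by
    calc _ = ∑ P : PauliString n, ∑ p : Qubits n × Qubits n, ∑ q : Qubits n × Qubits n,
          A p.1 p.2 * star (A q.1 q.2) *
            (P.toMatrix p.2 p.1 * star (P.toMatrix q.2 q.1)) := by
          refine Finset.sum_congr rfl fun P _ => ?_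
          rw [htr, star_sum, Finset.sum_mul_sum]
          refine Finset.sum_congr rfl fun p _ => Finset.sum_congr rfl fun q _ => ?_
          rw [star_mul']
          ring
      _ = ∑ p : Qubits n × Qubits n, ∑ q : Qubits n × Qubits n,
          A p.1 p.2 * star (A q.1 q.2) * (2 ^ n * if p = q then 1 else 0) := by
          rw [Finset.sum_comm]
          refine Finset.sum_congr rfl fun p _ => ?_
          rw [Finset.sum_comm]
          refine Finset.sum_congr rfl fun q _ => ?_
          rw [← Finset.mul_sum, PauliString.sum_mul_star]
          simp only [Matrix.one_apply, Prod.ext_iff, ite_and]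
          split_ifs <;> simp
      _ = _ := by
          simp only [mul_ite, mul_one, mul_zero, Finset.sum_ite_eq, Finset.mem_univ, if_true]
          rw [Finset.mul_sum, Fintype.sum_prod_type]
          simp only [Finset.mul_sum]
          refine Finset.sum_congr rfl fun p _ => Finset.sum_congr rfl fun q _ => ?_
          ring
  have hz (z : ℂ) : z * star z = ((‖z‖ ^ 2 : ℝ) : ℂ) := by
    simpa using Complex.mul_conj' z
  simp only [hz] at key
  exact_mod_cast key

theorem PauliString.card_eq : Fintype.card (PauliString n) = 4 ^ n := by
  simp [Pauli.card_eq]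

/-- Cauchy–Schwarz over the `4ⁿ` strings, then Parseval. Bounding each term by `tr A` would give
only `4ⁿ tr A`; the factor `2^(n/2)` gained here is the one in the lower bound. -/
theorem sum_norm_trace_mul_le {A : Matrix (Qubits n) (Qubits n) ℂ} (hA : A.PosSemidef) :
    ∑ P : PauliString n, ‖(A * P.toMatrix).trace‖ ≤ 2 ^ n * √(2 ^ n) * A.trace.re := by
  have htr : 0 ≤ A.trace.re := (Complex.nonneg_iff.mp hA.trace_nonneg).1
  refine abs_le_of_sq_le_sq' ?_ (by positivity) |>.2
  refine sq_sum_le_card_mul_sum_sq.trans ?_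
  rw [sum_norm_trace_mul_sq, Finset.card_univ, PauliString.card_eq, mul_pow, mul_pow,
    Real.sq_sqrt (by positivity)]
  push_cast
  rw [show (4 : ℝ) ^ n = (2 ^ n) ^ 2 by rw [← pow_mul, mul_comm, pow_mul]; norm_num, mul_assoc]
  gcongr
  exact sum_norm_sq_le_trace_sq hA

/-! ### Partial traces -/

/-- The partial trace over the second factor. -/
def traceRight {ι κ : Type*} [Fintype κ] (F : Matrix (ι × κ) (ι × κ) ℂ) : Matrix ι ι ℂ :=
  ∑ b, F.submatrix (fun a => (a, b)) fun a => (a, b)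

/-- The partial trace over the first factor. -/
def traceLeft {ι κ : Type*} [Fintype ι] (F : Matrix (ι × κ) (ι × κ) ℂ) : Matrix κ κ ℂ :=
  ∑ a, F.submatrix (fun b => (a, b)) fun b => (a, b)

theorem posSemidef_traceRight {ι κ : Type*} [Fintype κ] {F : Matrix (ι × κ) (ι × κ) ℂ}
    (hF : F.PosSemidef) : (traceRight F).PosSemidef :=
  posSemidef_sum _ fun _ _ => hF.submatrix _

theorem posSemidef_traceLeft {ι κ : Type*} [Fintype ι] {F : Matrix (ι × κ) (ι × κ) ℂ}
    (hF : F.PosSemidef) : (traceLeft F).PosSemidef :=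
  posSemidef_sum _ fun _ _ => hF.submatrix _

section PartialTrace

variable {ι κ : Type*} [Fintype ι] [Fintype κ] {F : Matrix (ι × κ) (ι × κ) ℂ}

theorem trace_traceRight : (traceRight F).trace = F.trace := by
  simp only [traceRight, Matrix.trace, Matrix.diag_apply, Matrix.sum_apply,
    Matrix.submatrix_apply, Fintype.sum_prod_type]

theorem trace_traceLeft : (traceLeft F).trace = F.trace := by
  simp only [traceLeft, Matrix.trace, Matrix.diag_apply, Matrix.sum_apply,
    Matrix.submatrix_apply, Fintype.sum_prod_type_right]

theorem trace_mul_kronecker_one [DecidableEq κ] (A : Matrix ι ι ℂ) :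
    (F * (A ⊗ₖ (1 : Matrix κ κ ℂ))).trace = (traceRight F * A).trace := by
  simp only [traceRight, Matrix.trace, Matrix.diag_apply, Matrix.mul_apply, Matrix.sum_apply,
    Matrix.submatrix_apply, Fintype.sum_prod_type, kroneckerMap_apply, Matrix.one_apply, mul_ite,
    mul_one, mul_zero, Finset.sum_ite_eq', Finset.mem_univ, if_true, Finset.sum_mul]

theorem trace_mul_one_kronecker [DecidableEq ι] (A : Matrix κ κ ℂ) :
    (F * ((1 : Matrix ι ι ℂ) ⊗ₖ A)).trace = (traceLeft F * A).trace := by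
  simp only [traceLeft, Matrix.trace, Matrix.diag_apply, Matrix.mul_apply, Matrix.sum_apply,
    Matrix.submatrix_apply, Fintype.sum_prod_type_right, kroneckerMap_apply, Matrix.one_apply,
    ite_mul, one_mul, zero_mul, mul_ite, mul_zero, Finset.sum_ite_eq', Finset.mem_univ, if_true,
    Finset.sum_mul]

end PartialTrace

/-! ### The hard states and how well one measurement separates them -/

/-- The state `2⁻ⁿ (I + s P)`, for a sign `s`. -/
noncomputable def pauliState (P : PauliString n) (s : ℝ) : Matrix (Qubits n) (Qubits n) ℂ :=
  ((2 : ℂ) ^ n)⁻¹ • (1 + (s : ℂ) • P.toMatrix)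

theorem isState_pauliState {P : PauliString n} (hP : P ≠ fun _ => .I) {s : ℝ} (hs : s * s = 1) :
    IsState (pauliState P s) := by
  have hs' : (s : ℂ) * s = 1 := by exact_mod_cast hs
  constructor
  -- Since `P² = 1` and `s² = 1`, the Hermitian matrix `1 + sP` is half its own square.
  · have h : pauliState P s =
        ((2 : ℂ) ^ n * 2)⁻¹ • ((1 + (s : ℂ) • P.toMatrix) * (1 + (s : ℂ) • P.toMatrix)ᴴ) := by
      have : (1 + (s : ℂ) • P.toMatrix) * (1 + (s : ℂ) • P.toMatrix)ᴴ =
          (2 : ℂ) • (1 + (s : ℂ) • P.toMatrix) := by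
        rw [conjTranspose_add, conjTranspose_smul, P.isHermitian.eq]
        simp only [conjTranspose_one, Complex.star_def, Complex.conj_ofReal, mul_add, add_mul,
          mul_one, one_mul, smul_mul_smul_comm, P.mul_self, hs', one_smul, two_smul]
        abel
      rw [this, smul_smul, pauliState]
      congr 1
      field_simp
    rw [h]
    refine (posSemidef_self_mul_conjTranspose _).smul ?_
    positivity
  · simp [pauliState, Matrix.trace_smul, PauliString.trace_eq_zero hP]

theorem trace_mul_pauliState {P : PauliString n} (hP : P ≠ fun _ => .I) (s : ℝ) :
    (P.toMatrix * pauliState P s).trace = s := by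
  simp [pauliState, mul_add, PauliString.mul_self, PauliString.trace_eq_zero hP]
  field_simp

/-- The `P ⊗ P` term carries `s² = 1` for both signs and cancels, so only one-copy information
survives. -/
theorem prob_pauliState_sub {Ω : Type} (M : TwoCopyPOVM n Ω) (ω : Ω) (P : PauliString n) :
    M.prob (pauliState P 1) ω - M.prob (pauliState P (-1)) ω ≤ 2 * ((4 : ℝ) ^ n)⁻¹ *
      (‖(traceRight (M.elem ω) * P.toMatrix).trace‖ +
        ‖(traceLeft (M.elem ω) * P.toMatrix).trace‖) := by
  have h : pauliState P 1 ⊗ₖ pauliState P 1 - pauliState P (-1) ⊗ₖ pauliState P (-1) =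
      ((2 * ((4 : ℝ) ^ n)⁻¹ : ℝ) : ℂ) • (P.toMatrix ⊗ₖ 1 + 1 ⊗ₖ P.toMatrix) := by
    ext p q
    have h4 : (4 : ℂ) ^ n = 2 ^ n * 2 ^ n := by rw [← mul_pow]; norm_num
    simp only [pauliState, kroneckerMap_apply, Matrix.sub_apply, Matrix.smul_apply,
      Matrix.add_apply, smul_eq_mul]
    push_cast
    rw [h4, mul_inv]
    ring
  rw [TwoCopyPOVM.prob, TwoCopyPOVM.prob, ← Complex.sub_re, ← Matrix.trace_sub,
    ← Matrix.mul_sub, h, Matrix.mul_smul, Matrix.trace_smul, smul_eq_mul, Complex.re_ofReal_mul,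
    Matrix.mul_add, Matrix.trace_add, trace_mul_kronecker_one, trace_mul_one_kronecker]
  gcongr
  exact (Complex.re_le_norm _).trans (norm_add_le _ _)

/-- Truncated subtraction in `ℝ≥0∞` makes the inner sum a total variation distance. Summing over `P`
for each outcome first leaves a multiple of the trace of the POVM element; these traces add up to
`4ⁿ`. -/
theorem sum_tsum_prob_sub_le {Ω : Type} (M : TwoCopyPOVM n Ω)
    {S : Finset (PauliString n)} (hS : ∀ P ∈ S, P ≠ fun _ => .I) :
    ∑ P ∈ S, ∑' ω, (ENNReal.ofReal (M.prob (pauliState P 1) ω) -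
      ENNReal.ofReal (M.prob (pauliState P (-1)) ω)) ≤ ENNReal.ofReal (4 * 2 ^ n * √(2 ^ n)) := by
  have hsum : HasSum (fun ω => (M.elem ω).trace.re) (4 ^ n) := by
    have h := M.hasSum_trace_mul 1
    simp only [mul_one, Matrix.trace_one, Fintype.card_prod, Fintype.card_fun, Fintype.card_fin]
      at h
    convert h using 1
    rw [← Nat.mul_pow, Complex.natCast_re]
    norm_num
  have htr (ω : Ω) : 0 ≤ (M.elem ω).trace.re :=
    (Complex.nonneg_iff.mp (M.posSemidef ω).trace_nonneg).1
  rw [← Summable.tsum_finsetSum fun _ _ => ENNReal.summable]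
  calc _ ≤ ∑' ω, ENNReal.ofReal (4 * ((4 : ℝ) ^ n)⁻¹ * 2 ^ n * √(2 ^ n) *
        (M.elem ω).trace.re) := by
        refine ENNReal.tsum_le_tsum fun ω => ?_
        calc _ ≤ ∑ P ∈ S, ENNReal.ofReal (2 * ((4 : ℝ) ^ n)⁻¹ *
              (‖(traceRight (M.elem ω) * P.toMatrix).trace‖ +
                ‖(traceLeft (M.elem ω) * P.toMatrix).trace‖)) := by
              refine Finset.sum_le_sum fun P hP => ?_
              rw [← ENNReal.ofReal_sub _
                ((isState_pauliState (hS P hP) (by norm_num)).prob_nonneg M ω)]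
              exact ENNReal.ofReal_le_ofReal (prob_pauliState_sub M ω P)
          _ ≤ _ := by
              rw [← ENNReal.ofReal_sum_of_nonneg fun _ _ => by positivity]
              refine ENNReal.ofReal_le_ofReal ?_
              refine (Finset.sum_le_univ_sum_of_nonneg fun _ => by positivity).trans ?_
              rw [← Finset.mul_sum, Finset.sum_add_distrib]
              have h1 := sum_norm_trace_mul_le (posSemidef_traceRight (M.posSemidef ω))
              have h2 := sum_norm_trace_mul_le (posSemidef_traceLeft (M.posSemidef ω))
              rw [trace_traceRight] at h1
              rw [trace_traceLeft] at h2
              calc _ ≤ 2 * ((4 : ℝ) ^ n)⁻¹ * (2 ^ n * √(2 ^ n) * (M.elem ω).trace.re +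
                    2 ^ n * √(2 ^ n) * (M.elem ω).trace.re) := by gcongr
                _ = _ := by ring
    _ = _ := by
        rw [← ENNReal.ofReal_tsum_of_nonneg (fun ω => mul_nonneg (by positivity) (htr ω))
          (hsum.summable.mul_left _), tsum_mul_left, hsum.tsum_eq]
        congr 1
        field_simp

/-! ### Product distributions and the nonadaptive lower bound -/

theorem tsum_prod_eq_prod_tsum {Ω : Type*} {T : ℕ} (f : Fin T → Ω → ℝ≥0∞) :
    ∑' s : Fin T → Ω, ∏ t, f t (s t) = ∏ t, ∑' ω, f t ω := by
  induction T with
  | zero => simp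
  | succ T ih =>
    rw [← (Fin.consEquiv fun _ => Ω).tsum_eq, ENNReal.tsum_prod', Fin.prod_univ_succ,
      ← ih fun t => f t.succ, ← ENNReal.tsum_mul_right]
    refine tsum_congr fun ω => ?_
    rw [← ENNReal.tsum_mul_left]
    refine tsum_congr fun s => ?_
    simp [Fin.prod_univ_succ, Fin.consEquiv]

/-- Subadditivity of the total variation distance of product distributions. -/
theorem tsum_prod_sub_prod_le {Ω : Type*} {T : ℕ} (f g : Fin T → Ω → ℝ≥0∞)
    (hf : ∀ t, ∑' ω, f t ω = 1) (hg : ∀ t, ∑' ω, g t ω = 1) :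
    ∑' s : Fin T → Ω, (∏ t, f t (s t) - ∏ t, g t (s t)) ≤ ∑ t, ∑' ω, (f t ω - g t ω) := by
  induction T with
  | zero => simp
  | succ T ih =>
    -- The hybrid step `ab - cd = a(b - d) + (a - c)d`, for truncated subtraction.
    have hmul (a b c d : ℝ≥0∞) : a * b - c * d ≤ a * (b - d) + (a - c) * d := by
      rw [tsub_le_iff_right]
      calc a * b ≤ a * (b - d + d) := by gcongr; exact le_tsub_add
        _ = a * (b - d) + a * d := mul_add _ _ _
        _ ≤ a * (b - d) + (a - c + c) * d := by gcongr; exact le_tsub_add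
        _ = _ := by ring
    rw [← (Fin.consEquiv fun _ => Ω).tsum_eq, ENNReal.tsum_prod', Fin.sum_univ_succ,
      add_comm (∑' ω, _)]
    calc _ ≤ ∑' ω, ∑' s : Fin T → Ω, (f 0 ω * (∏ t, f t.succ (s t) - ∏ t, g t.succ (s t)) +
          (f 0 ω - g 0 ω) * ∏ t, g t.succ (s t)) := by
          refine ENNReal.tsum_le_tsum fun ω => ENNReal.tsum_le_tsum fun s => ?_
          simp only [Fin.prod_univ_succ, Fin.consEquiv, Equiv.coe_fn_mk, Fin.cons_zero,
            Fin.cons_succ]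
          exact hmul _ _ _ _
      _ = ∑' s : Fin T → Ω, (∏ t, f t.succ (s t) - ∏ t, g t.succ (s t)) +
          ∑' ω, (f 0 ω - g 0 ω) := by
          simp only [ENNReal.tsum_add, ENNReal.tsum_mul_left, ENNReal.tsum_mul_right, hf,
            tsum_prod_eq_prod_tsum fun t => g t.succ, hg, Finset.prod_const_one, one_mul, mul_one]
      _ ≤ _ := by
          gcongr
          exact ih _ _ (fun t => hf _) fun t => hg _

/-- A nonadaptive protocol that estimates the sign of `P` succeeds on the two states
`2⁻ⁿ (I ± P)` only as far as its measurements distinguish these. -/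
theorem Protocol.tsum_isGood_add_le (A : Protocol n) (r : A.Seed)
    (M : Fin A.rounds → TwoCopyPOVM n A.Outcome) (hM : ∀ t h, A.measurement r t h = M t)
    {P : PauliString n} (hP : P ≠ fun _ => .I) :
    letI := Classical.propDecidable
    (∑' s, if A.IsGood (pauliState P 1) 1 r s then A.transcriptProb (pauliState P 1) r s else 0) +
      (∑' s, if A.IsGood (pauliState P (-1)) 1 r s then
        A.transcriptProb (pauliState P (-1)) r s else 0) ≤
      1 + ∑ t, ∑' ω, (ENNReal.ofReal ((M t).prob (pauliState P 1) ω) -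
        ENNReal.ofReal ((M t).prob (pauliState P (-1)) ω)) := by
  classical
  have hsum (s : ℝ) (hs : s * s = 1) (t : Fin A.rounds) :
      ∑' ω, ENNReal.ofReal ((M t).prob (pauliState P s) ω) = 1 := by
    have hσ := isState_pauliState hP hs
    rw [← ENNReal.ofReal_tsum_of_nonneg (hσ.prob_nonneg (M t)) (hσ.hasSum_prob (M t)).summable,
      (hσ.hasSum_prob (M t)).tsum_eq, ENNReal.ofReal_one]
  have h1 := hsum 1 (by norm_num)
  have h2 := hsum (-1) (by norm_num)
  simp only [transcriptProb, hM]
  rw [← ENNReal.tsum_add]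
  calc _ ≤ ∑' s : Fin A.rounds → A.Outcome,
        (∏ t, ENNReal.ofReal ((M t).prob (pauliState P (-1)) (s t)) +
        (∏ t, ENNReal.ofReal ((M t).prob (pauliState P 1) (s t)) -
          ∏ t, ENNReal.ofReal ((M t).prob (pauliState P (-1)) (s t)))) := by
        refine ENNReal.tsum_le_tsum fun s => ?_
        -- No number is within distance less than 1 of both `1` and `-1`, so each transcript counts
        -- for at most one of the two states and contributes at most the larger of the two
        -- probabilities.
        have hdisj : ¬ (A.IsGood (pauliState P 1) 1 r s ∧
            A.IsGood (pauliState P (-1)) 1 r s) := by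
          rintro ⟨hp, hm⟩
          have hp := hp P
          have hm := hm P
          rw [trace_mul_pauliState hP, ← Complex.ofReal_sub, Complex.norm_real, Real.norm_eq_abs,
            abs_lt] at hp hm
          linarith [hp.1, hm.2]
        split_ifs with hp hm
        · exact absurd ⟨hp, hm⟩ hdisj
        · rw [add_zero]
          exact le_add_tsub
        · rw [zero_add]
          exact le_self_add
        · simp
    _ ≤ _ := by
        rw [ENNReal.tsum_add, tsum_prod_eq_prod_tsum fun t ω =>
          ENNReal.ofReal ((M t).prob (pauliState P (-1)) ω)]
        gcongr
        · simp [h2]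
        · exact tsum_prod_sub_prod_le _ _ h1 h2

theorem Protocol.exists_measurement (A : Protocol n) (hA : A.IsNonadaptive) (r : A.Seed)
    (s : Fin A.rounds → A.Outcome) :
    ∃ M : Fin A.rounds → TwoCopyPOVM n A.Outcome, ∀ t h, A.measurement r t h = M t :=
  ⟨fun t => A.measurement r t fun i => s (Fin.castLE t.isLt.le i), fun _ _ => hA _ _ _ _⟩

/-- Given the seed, the same measurements face every `P`, so the sum over `P` can be taken round by
round. Adaptive choices would follow histories whose distribution depends on `P`. -/
theorem Protocol.sum_successProb_le (A : Protocol n) (hA : A.IsNonadaptive)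
    {S : Finset (PauliString n)} (hS : ∀ P ∈ S, P ≠ fun _ => .I) :
    ∑ P ∈ S, (A.successProb (pauliState P 1) 1 + A.successProb (pauliState P (-1)) 1) ≤
      #S + A.rounds * ENNReal.ofReal (4 * 2 ^ n * √(2 ^ n)) := by
  classical
  simp only [successProb, ← ENNReal.tsum_add, ← mul_add]
  rw [← Summable.tsum_finsetSum fun _ _ => ENNReal.summable]
  simp only [← Finset.mul_sum]
  calc _ ≤ ∑' r, A.seedDist r * (#S + A.rounds * ENNReal.ofReal (4 * 2 ^ n * √(2 ^ n))) := by
        refine ENNReal.tsum_le_tsum fun r => ?_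
        gcongr
        -- A transcript is needed only to supply a history at which each measurement is read off;
        -- without one the success sums are empty.
        rcases isEmpty_or_nonempty (Fin A.rounds → A.Outcome) with hempty | ⟨⟨s⟩⟩
        · simp
        obtain ⟨M, hM⟩ := A.exists_measurement hA r s
        simp only [ENNReal.tsum_add]
        refine (Finset.sum_le_sum fun P hP => A.tsum_isGood_add_le r M hM (hS P hP)).trans ?_
        rw [Finset.sum_add_distrib, Finset.sum_comm]
        gcongr
        · simp
        · refine (Finset.sum_le_sum fun t _ => sum_tsum_prob_sub_le (M t) hS).trans ?_
          simp
    _ = _ := by rw [ENNReal.tsum_mul_right, A.seedDist.tsum_coe, one_mul]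

theorem Protocol.le_rounds_of_solves (A : Protocol n) (hn : 1 ≤ n) (hA : A.IsNonadaptive) {δ : ℝ}
    (hδ : δ < 1 / 2) (h : A.Solves 1 δ) : (1 - 2 * δ) / 8 * √(2 ^ n) ≤ A.rounds := by
  classical
  set S : Finset (PauliString n) := univ.erase fun _ => .I with hSdef
  have hS : ∀ P ∈ S, P ≠ fun _ => .I := fun P hP => (Finset.mem_erase.mp hP).1
  have hcard : (#S : ℝ) = 4 ^ n - 1 := by
    rw [hSdef, Finset.card_erase_of_mem (Finset.mem_univ _), Finset.card_univ,
      PauliString.card_eq, Nat.cast_sub (Nat.one_le_pow _ _ (by norm_num))]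
    simp
  have hle := A.sum_successProb_le hA hS
  have hge : ∑ P ∈ S, ENNReal.ofReal (2 * (1 - δ)) ≤
      ∑ P ∈ S, (A.successProb (pauliState P 1) 1 + A.successProb (pauliState P (-1)) 1) := by
    refine Finset.sum_le_sum fun P hP => ?_
    rw [two_mul, ENNReal.ofReal_add (by linarith) (by linarith)]
    exact add_le_add (h _ (isState_pauliState (hS P hP) (by norm_num)))
      (h _ (isState_pauliState (hS P hP) (by norm_num)))
  have hmain := hge.trans hle
  rw [Finset.sum_const, nsmul_eq_mul, ← ENNReal.ofReal_natCast, ← ENNReal.ofReal_natCast,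
    ← ENNReal.ofReal_mul (by positivity), ← ENNReal.ofReal_mul (by positivity),
    ← ENNReal.ofReal_add (by positivity) (by positivity),
    ENNReal.ofReal_le_ofReal_iff (by positivity), hcard] at hmain
  set w : ℝ := √(2 ^ n) with hw
  have hw2 : w * w = 2 ^ n := Real.mul_self_sqrt (by positivity)
  have h4 : (4 : ℝ) ^ n = (2 ^ n) ^ 2 := by rw [← pow_mul, mul_comm, pow_mul]; norm_num
  have hw1 : (2 : ℝ) ≤ 2 ^ n := by simpa using pow_le_pow_right₀ (by norm_num : (1 : ℝ) ≤ 2) hn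
  have hwpos : 0 < w := Real.sqrt_pos.mpr (by positivity)
  rw [h4] at hmain
  have hw3 : (0 : ℝ) < 4 * 2 ^ n * w := by positivity
  refine le_of_mul_le_mul_right ?_ hw3
  -- Dropping the identity string costs at most a factor 2, which with the 4 from the distance bound
  -- makes the 8.
  have : (1 - 2 * δ) * (((2 : ℝ) ^ n) ^ 2 / 2) ≤ (1 - 2 * δ) * ((2 ^ n) ^ 2 - 1) := by
    refine mul_le_mul_of_nonneg_left ?_ (by linarith)
    nlinarith
  calc _ = (1 - 2 * δ) * ((2 ^ n * (w * w)) / 2) := by ring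
    _ = (1 - 2 * δ) * (((2 : ℝ) ^ n) ^ 2 / 2) := by rw [hw2]; ring
    _ ≤ _ := by linarith

/-! ### Chernoff and union bounds -/

section Concentration

variable {Ω : Type*} [Fintype Ω]

/-- By `exp x ≤ 1 + x + x²` for `|x| ≤ 1`: the linear term has mean zero and the variance is at most
1. The range of `l` is what `|f ω - μ| ≤ 2` requires. -/
theorem sum_mul_exp_le {p f : Ω → ℝ} (hp : ∀ ω, 0 ≤ p ω) (hp1 : ∑ ω, p ω = 1)
    (hf : ∀ ω, |f ω| ≤ 1) {l : ℝ} (hl : 0 ≤ l) (hl' : l ≤ 1 / 2) :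
    ∑ ω, p ω * Real.exp (l * (f ω - ∑ ω, p ω * f ω)) ≤ Real.exp (l ^ 2) := by
  set μ := ∑ ω, p ω * f ω with hμ
  have hμ1 : |μ| ≤ 1 := by
    refine (Finset.abs_sum_le_sum_abs _ _).trans ?_
    rw [← hp1]
    refine Finset.sum_le_sum fun ω _ => ?_
    rw [abs_mul, abs_of_nonneg (hp ω)]
    exact mul_le_of_le_one_right (hp ω) (hf ω)
  have hexp (ω : Ω) : Real.exp (l * (f ω - μ)) ≤ 1 + l * (f ω - μ) + l ^ 2 * (f ω - μ) ^ 2 := by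
    have hx : |l * (f ω - μ)| ≤ 1 := by
      rw [abs_mul, abs_of_nonneg hl]
      have : |f ω - μ| ≤ 2 := (abs_sub _ _).trans (by linarith [hf ω])
      nlinarith [abs_nonneg (f ω - μ)]
    have := (abs_le.mp (Real.abs_exp_sub_one_sub_id_le hx)).2
    linarith [mul_pow l (f ω - μ) 2]
  have hsq : ∑ ω, p ω * f ω ^ 2 ≤ 1 := by
    rw [← hp1]
    refine Finset.sum_le_sum fun ω _ => mul_le_of_le_one_right (hp ω) ?_
    exact (sq_le_one_iff_abs_le_one _).mpr (hf ω)
  calc _ ≤ ∑ ω, p ω * (1 + l * (f ω - μ) + l ^ 2 * (f ω - μ) ^ 2) := by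
        gcongr with ω
        · exact hp ω
        · exact hexp ω
    _ = ∑ ω, ((1 - l * μ + l ^ 2 * μ ^ 2) * p ω + (l - 2 * l ^ 2 * μ) * (p ω * f ω) +
          l ^ 2 * (p ω * f ω ^ 2)) := Finset.sum_congr rfl fun ω _ => by ring
    _ = 1 + l ^ 2 * (∑ ω, p ω * f ω ^ 2 - μ ^ 2) := by
        rw [Finset.sum_add_distrib, Finset.sum_add_distrib, ← Finset.mul_sum, ← Finset.mul_sum,
          ← Finset.mul_sum, hp1, ← hμ]
        ring
    _ ≤ 1 + l ^ 2 := by nlinarith [sq_nonneg μ, sq_nonneg l]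
    _ ≤ _ := by linarith [Real.add_one_le_exp (l ^ 2)]

theorem sum_prod_ite_le_exp {p f : Ω → ℝ} (hp : ∀ ω, 0 ≤ p ω) (hp1 : ∑ ω, p ω = 1)
    (hf : ∀ ω, |f ω| ≤ 1) {τ : ℝ} (hτ : 0 ≤ τ) (hτ1 : τ ≤ 1) (T : ℕ)
    {E : (Fin T → Ω) → Prop} [DecidablePred E]
    (hE : ∀ s, E s → T * τ ≤ ∑ t, f (s t) - T * ∑ ω, p ω * f ω) :
    ∑ s : Fin T → Ω, (if E s then ∏ t, p (s t) else 0) ≤ Real.exp (-(T * (τ ^ 2 / 4))) := by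
  set μ := ∑ ω, p ω * f ω with hμ
  -- The indicator is dominated by an exponential that factors over rounds; `l = τ / 2` minimizes
  -- `l² - lτ`, with value `-τ²/4`.
  calc _ ≤ ∑ s : Fin T → Ω, ∏ t, p (s t) * Real.exp (τ / 2 * (f (s t) - μ) - τ / 2 * τ) := by
        refine Finset.sum_le_sum fun s _ => ?_
        rw [Finset.prod_mul_distrib, ← Real.exp_sum, Finset.sum_sub_distrib, ← Finset.mul_sum,
          Finset.sum_sub_distrib]
        simp only [Finset.sum_const, Finset.card_univ, Fintype.card_fin, nsmul_eq_mul]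
        split_ifs with hs
        · refine le_mul_of_one_le_right (Finset.prod_nonneg fun _ _ => hp _) (Real.one_le_exp ?_)
          nlinarith [hE s hs]
        · exact mul_nonneg (Finset.prod_nonneg fun _ _ => hp _) (Real.exp_pos _).le
    _ = (∑ ω, p ω * Real.exp (τ / 2 * (f ω - μ) - τ / 2 * τ)) ^ T := by
        rw [← Fintype.prod_sum fun (_ : Fin T) ω =>
          p ω * Real.exp (τ / 2 * (f ω - μ) - τ / 2 * τ)]
        simp
    _ ≤ Real.exp (-(τ ^ 2 / 4)) ^ T := by
        refine pow_le_pow_left₀ (Finset.sum_nonneg fun ω _ =>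
          mul_nonneg (hp ω) (Real.exp_pos _).le) ?_ T
        simp only [Real.exp_sub, ← mul_div_assoc]
        rw [← Finset.sum_div, div_le_iff₀ (Real.exp_pos _), ← Real.exp_add]
        refine (sum_mul_exp_le hp hp1 hf (by linarith) (by linarith)).trans_eq ?_
        congr 1
        ring
    _ = _ := by
        rw [← Real.exp_nat_mul]
        congr 1
        ring

end Concentration

/-- The empirical average of the eigenvalue of `P ⊗ P` over Bell measurement outcomes. -/
noncomputable def bellAverage {T : ℕ} (s : Fin T → PauliString n) (P : PauliString n) : ℝ :=
  (∑ t, P.bellSign (s t)) / T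

/-- All empirical averages are within `τ` of their means under `p`. -/
def IsAccurate (p : PauliString n → ℝ) (τ : ℝ) {T : ℕ} (s : Fin T → PauliString n) : Prop :=
  ∀ P : PauliString n, |bellAverage s P - ∑ Q, p Q * P.bellSign Q| < τ

open Classical in
theorem sum_not_isAccurate_le {p : PauliString n → ℝ} (hp : ∀ Q, 0 ≤ p Q) (hp1 : ∑ Q, p Q = 1)
    {τ : ℝ} (hτ : 0 ≤ τ) (hτ1 : τ ≤ 1) {T : ℕ} (hT : 0 < T) :
    ∑ s : Fin T → PauliString n, (if ¬ IsAccurate p τ s then ∏ t, p (s t) else 0) ≤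
      4 ^ n * (2 * Real.exp (-(T * (τ ^ 2 / 4)))) := by
  have hT' : (0 : ℝ) < T := Nat.cast_pos.mpr hT
  have hprod (s : Fin T → PauliString n) : 0 ≤ ∏ t, p (s t) := Finset.prod_nonneg fun _ _ => hp _
  -- The sign `e` selects the upper or the lower tail.
  have htail (P : PauliString n) (e : ℝ) (he : |e| = 1) :
      ∑ s : Fin T → PauliString n, (if τ ≤ e * (bellAverage s P - ∑ Q, p Q * P.bellSign Q)
        then ∏ t, p (s t) else 0) ≤ Real.exp (-(T * (τ ^ 2 / 4))) := by
    refine sum_prod_ite_le_exp (f := fun Q => e * P.bellSign Q) hp hp1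
      (fun Q => by rw [abs_mul, he, P.abs_bellSign, one_mul]) hτ hτ1 T fun s hs => ?_
    have h : T * τ ≤ T * (e * (bellAverage s P - ∑ Q, p Q * P.bellSign Q)) := by gcongr
    refine h.trans_eq ?_
    rw [bellAverage, ← Finset.mul_sum]
    simp only [mul_left_comm _ e, ← Finset.mul_sum]
    field_simp
  calc _ ≤ ∑ s : Fin T → PauliString n, ∑ P : PauliString n,
        ((if τ ≤ 1 * (bellAverage s P - ∑ Q, p Q * P.bellSign Q) then ∏ t, p (s t) else 0) +
          if τ ≤ -1 * (bellAverage s P - ∑ Q, p Q * P.bellSign Q) then ∏ t, p (s t) else 0) := by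
        refine Finset.sum_le_sum fun s _ => ?_
        have hnn (P : PauliString n) : 0 ≤
            (if τ ≤ 1 * (bellAverage s P - ∑ Q, p Q * P.bellSign Q) then ∏ t, p (s t) else 0) +
            if τ ≤ -1 * (bellAverage s P - ∑ Q, p Q * P.bellSign Q) then ∏ t, p (s t) else 0 :=
          add_nonneg (by split_ifs <;> [exact hprod s; rfl])
            (by split_ifs <;> [exact hprod s; rfl])
        by_cases hs : IsAccurate p τ s
        · rw [if_neg (not_not.mpr hs)]
          exact Finset.sum_nonneg fun P _ => hnn P
        · rw [if_pos hs]
          obtain ⟨P, hP⟩ := not_forall.mp hs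
          refine le_trans ?_ (Finset.single_le_sum (fun P _ => hnn P) (Finset.mem_univ P))
          rcases le_abs.mp (not_lt.mp hP) with h | h
          · rw [if_pos (by linarith)]
            refine le_add_of_nonneg_right ?_
            split_ifs <;> [exact hprod s; rfl]
          · rw [add_comm, if_pos (by linarith)]
            refine le_add_of_nonneg_right ?_
            split_ifs <;> [exact hprod s; rfl]
    _ ≤ ∑ P : PauliString n, 2 * Real.exp (-(T * (τ ^ 2 / 4))) := by
        rw [Finset.sum_comm]
        refine Finset.sum_le_sum fun P _ => ?_
        rw [Finset.sum_add_distrib, two_mul]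
        exact add_le_add (htail P 1 (by simp)) (htail P (-1) (by simp))
    _ = _ := by rw [Finset.sum_const, Finset.card_univ, PauliString.card_eq]; simp

theorem sum_prod_eq_one {Ω : Type*} [Fintype Ω] {p : Ω → ℝ} (hp1 : ∑ ω, p ω = 1) (T : ℕ) :
    ∑ s : Fin T → Ω, ∏ t, p (s t) = 1 := by
  rw [← Fintype.prod_sum fun (_ : Fin T) ω => p ω]
  simp [hp1]

open Classical in
/-- Two consecutive rounds of estimation, where the second distribution depends on the outcomes of
the first round, are both accurate with high probability. -/
theorem le_sum_isAccurate {p : PauliString n → ℝ} (hp : ∀ Q, 0 ≤ p Q) (hp1 : ∑ Q, p Q = 1)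
    {T : ℕ} {q : (Fin T → PauliString n) → PauliString n → ℝ} (hq : ∀ s Q, 0 ≤ q s Q)
    (hq1 : ∀ s, ∑ Q, q s Q = 1) {τ : ℝ} (hτ : 0 ≤ τ) (hτ1 : τ ≤ 1) (hT : 0 < T) :
    1 - 4 ^ n * (4 * Real.exp (-(T * (τ ^ 2 / 4)))) ≤
      ∑ s : Fin T → PauliString n, ∑ s' : Fin T → PauliString n,
        if IsAccurate p τ s ∧ IsAccurate (q s) τ s' then
          (∏ t, p (s t)) * ∏ t, q s (s' t) else 0 := by
  have hprod (s : Fin T → PauliString n) : 0 ≤ ∏ t, p (s t) := Finset.prod_nonneg fun _ _ => hp _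
  have hprod' (s s' : Fin T → PauliString n) : 0 ≤ ∏ t, q s (s' t) :=
    Finset.prod_nonneg fun _ _ => hq _ _
  have h1 := sum_not_isAccurate_le hp hp1 hτ hτ1 hT
  -- The tail bound is uniform in the distribution, so it holds conditionally on every `s`.
  have h2 : ∑ s : Fin T → PauliString n, (∏ t, p (s t)) * ∑ s' : Fin T → PauliString n,
      (if ¬ IsAccurate (q s) τ s' then ∏ t, q s (s' t) else 0) ≤
      4 ^ n * (2 * Real.exp (-(T * (τ ^ 2 / 4)))) := by
    calc _ ≤ ∑ s : Fin T → PauliString n, (∏ t, p (s t)) *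
          (4 ^ n * (2 * Real.exp (-(T * (τ ^ 2 / 4))))) := by
          gcongr with s
          · exact hprod s
          · exact sum_not_isAccurate_le (hq s) (hq1 s) hτ hτ1 hT
      _ = _ := by rw [← Finset.sum_mul, sum_prod_eq_one hp1, one_mul]
  have h3 : (1 : ℝ) = ∑ s : Fin T → PauliString n, (∏ t, p (s t)) *
      ∑ s' : Fin T → PauliString n, ∏ t, q s (s' t) := by
    simp only [sum_prod_eq_one (hq1 _), mul_one, sum_prod_eq_one hp1]
  have h4 : (1 : ℝ) ≤ ∑ s : Fin T → PauliString n, ∑ s' : Fin T → PauliString n,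
        (if IsAccurate p τ s ∧ IsAccurate (q s) τ s' then
          (∏ t, p (s t)) * ∏ t, q s (s' t) else 0) +
      ∑ s : Fin T → PauliString n, (if ¬ IsAccurate p τ s then ∏ t, p (s t) else 0) +
      ∑ s : Fin T → PauliString n, (∏ t, p (s t)) * ∑ s' : Fin T → PauliString n,
        (if ¬ IsAccurate (q s) τ s' then ∏ t, q s (s' t) else 0) := by
    rw [h3, ← Finset.sum_add_distrib, ← Finset.sum_add_distrib]
    refine Finset.sum_le_sum fun s _ => ?_
    by_cases hs : IsAccurate p τ s
    · simp only [hs, true_and, not_true_eq_false, if_false, add_zero, Finset.mul_sum,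
        ← Finset.sum_add_distrib]
      refine Finset.sum_le_sum fun s' _ => ?_
      split_ifs <;> simp
    · simp only [hs, false_and, not_false_eq_true, if_true, if_false, Finset.sum_const_zero,
        zero_add, sum_prod_eq_one (hq1 s), mul_one]
      refine le_add_of_nonneg_right (mul_nonneg (hprod s) (Finset.sum_nonneg fun s' _ => ?_))
      split_ifs <;> [rfl; exact hprod' s s']
  linarith

/-! ### Bell measurements of `σ ⊗ σ` and of `σ ⊗ ρ` -/

/-- The matrix element of the Bell measurement for the Bell state with label `Q`. -/
noncomputable def bellElem (Q : PauliString n) :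
    Matrix (Qubits n × Qubits n) (Qubits n × Qubits n) ℂ :=
  ((2 : ℂ) ^ n)⁻¹ • vecMulVec (fun p => Q.toMatrix p.1 p.2) (star fun p => Q.toMatrix p.1 p.2)

theorem sum_bellSign_smul_bellElem (P : PauliString n) :
    ∑ Q : PauliString n, (P.bellSign Q : ℂ) • bellElem Q = P.toMatrix ⊗ₖ P.toMatrix := by
  ext p q
  have h := P.sum_bellSign p.1 p.2 q.1 q.2
  simp only [bellElem, Matrix.sum_apply, Matrix.smul_apply, vecMulVec_apply, Pi.star_apply,
    smul_eq_mul, kroneckerMap_apply, mul_left_comm _ ((2 : ℂ) ^ n)⁻¹, ← Finset.mul_sum, h]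
  field_simp

/-- The measurement of two copies in the Bell basis. -/
noncomputable def bellPOVM (n : ℕ) : TwoCopyPOVM n (PauliString n) where
  elem := bellElem
  posSemidef Q := (posSemidef_vecMulVec_self_star _).smul (by positivity)
  hasSum_one := by
    convert hasSum_fintype (bellElem (n := n)) using 1
    simpa [PauliString.bellSign_I, PauliString.toMatrix_I] using
      (sum_bellSign_smul_bellElem fun _ : Fin n => Pauli.I).symm

/-- The operator measured on the first factor when `σ ⊗ ρ`, for a fixed `ρ`, is measured in the
Bell basis. -/
noncomputable def assistedElem (ρ : Matrix (Qubits n) (Qubits n) ℂ) (Q : PauliString n) :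
    Matrix (Qubits n) (Qubits n) ℂ :=
  ((2 : ℂ) ^ n)⁻¹ • (Q.toMatrix * ρᵀ * Q.toMatrixᴴ)

/-- Pairing the second factor of the decomposition of `P ⊗ P` with `ρ` leaves `tr(Pρ) P`. For `P =
I` this is the completeness of the measurement. -/
theorem sum_bellSign_smul_assistedElem (ρ : Matrix (Qubits n) (Qubits n) ℂ) (P : PauliString n) :
    ∑ Q : PauliString n, (P.bellSign Q : ℂ) • assistedElem ρ Q =
      (P.toMatrix * ρ).trace • P.toMatrix := by
  ext a c
  calc _ = ∑ Q : PauliString n, ∑ d, ∑ b, ((2 : ℂ) ^ n)⁻¹ * (ρ d b *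
        ((P.bellSign Q : ℂ) * (Q.toMatrix a b * star (Q.toMatrix c d)))) := by
        simp only [assistedElem, Matrix.sum_apply, Matrix.smul_apply, Matrix.mul_apply,
          smul_eq_mul, transpose_apply, conjTranspose_apply, Finset.sum_mul, Finset.mul_sum]
        refine Finset.sum_congr rfl fun Q _ => Finset.sum_congr rfl fun d _ =>
          Finset.sum_congr rfl fun b _ => ?_
        ring
    _ = ∑ d, ∑ b, ((2 : ℂ) ^ n)⁻¹ * (ρ d b * (2 ^ n * (P.toMatrix a c * P.toMatrix b d))) := by
        rw [Finset.sum_comm]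
        refine Finset.sum_congr rfl fun d _ => ?_
        rw [Finset.sum_comm]
        refine Finset.sum_congr rfl fun b _ => ?_
        rw [← Finset.mul_sum, ← Finset.mul_sum, P.sum_bellSign]
    _ = _ := by
        rw [Finset.sum_comm]
        simp only [Matrix.smul_apply, smul_eq_mul, Matrix.trace, Matrix.diag_apply,
          Matrix.mul_apply, Finset.sum_mul]
        refine Finset.sum_congr rfl fun d _ => Finset.sum_congr rfl fun b _ => ?_
        field_simp

/-- The measurement of `σ ⊗ ρ` in the Bell basis, where `σ` is the first of the two copies and `ρ`
is a fixed state. -/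
noncomputable def assistedPOVM (ρ : Matrix (Qubits n) (Qubits n) ℂ) (hρ : IsState ρ) :
    TwoCopyPOVM n (PauliString n) where
  -- The second copy of `σ` is discarded; the known state `ρ` is absorbed into the operator on the
  -- first.
  elem Q := assistedElem ρ Q ⊗ₖ 1
  posSemidef Q := by
    refine PosSemidef.kronecker (.smul (hρ.1.transpose.mul_mul_conjTranspose_same _) ?_) .one
    positivity
  hasSum_one := by
    convert hasSum_fintype fun Q => assistedElem ρ Q ⊗ₖ (1 : Matrix (Qubits n) (Qubits n) ℂ)
      using 1
    have h := sum_bellSign_smul_assistedElem ρ fun _ => .I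
    simp only [PauliString.bellSign_I, PauliString.toMatrix_I, Matrix.one_mul, hρ.2,
      Complex.ofReal_one, one_smul] at h
    rw [← one_kronecker_one, ← h]
    ext p q
    simp [kroneckerMap_apply, Matrix.sum_apply, Finset.sum_mul]

theorem IsState.trace_mul_eq {σ : Matrix (Qubits n) (Qubits n) ℂ} (hσ : IsState σ)
    (P : PauliString n) :
    (P.toMatrix * σ).trace = ((P.toMatrix * σ).trace.re : ℂ) := by
  refine (Complex.conj_eq_iff_re.mp ?_).symm
  rw [starRingEnd_apply, ← Matrix.trace_conjTranspose, conjTranspose_mul, P.isHermitian.eq,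
    hσ.1.isHermitian.eq, Matrix.trace_mul_comm]

variable {σ : Matrix (Qubits n) (Qubits n) ℂ}

theorem sum_bellPOVM_prob (hσ : IsState σ) (P : PauliString n) :
    ∑ Q, (bellPOVM n).prob σ Q * P.bellSign Q = (P.toMatrix * σ).trace.re ^ 2 := by
  have h : ∑ Q, (P.bellSign Q : ℂ) * (bellElem Q * (σ ⊗ₖ σ)).trace =
      (P.toMatrix * σ).trace * (P.toMatrix * σ).trace := by
    rw [← trace_kronecker, mul_kronecker_mul, ← sum_bellSign_smul_bellElem, Finset.sum_mul,
      Matrix.trace_sum]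
    simp [Matrix.trace_smul]
  rw [hσ.trace_mul_eq, ← Complex.ofReal_mul] at h
  have h' := congrArg Complex.re h
  rw [Complex.re_sum, Complex.ofReal_re, ← sq] at h'
  rw [← h']
  refine Finset.sum_congr rfl fun Q _ => ?_
  rw [Complex.re_ofReal_mul, mul_comm]
  rfl

/-- In contrast to the square obtained from `σ ⊗ σ`, this mean is linear in `σ` and reveals the
sign. -/
theorem sum_assistedPOVM_prob (hσ : IsState σ) {ρ : Matrix (Qubits n) (Qubits n) ℂ}
    (hρ : IsState ρ) (P : PauliString n) :
    ∑ Q, (assistedPOVM ρ hρ).prob σ Q * P.bellSign Q =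
      (P.toMatrix * ρ).trace.re * (P.toMatrix * σ).trace.re := by
  have h : ∑ Q, (P.bellSign Q : ℂ) * ((assistedElem ρ Q ⊗ₖ 1) * (σ ⊗ₖ σ)).trace =
      (P.toMatrix * ρ).trace * (P.toMatrix * σ).trace := by
    simp only [← mul_kronecker_mul, trace_kronecker, Matrix.one_mul, hσ.2, mul_one]
    rw [← smul_eq_mul (P.toMatrix * ρ).trace, ← Matrix.trace_smul, ← Matrix.smul_mul,
      ← sum_bellSign_smul_assistedElem, Finset.sum_mul, Matrix.trace_sum]
    simp [Matrix.trace_smul]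
  rw [hσ.trace_mul_eq, hρ.trace_mul_eq, ← Complex.ofReal_mul] at h
  have h' := congrArg Complex.re h
  rw [Complex.re_sum, Complex.ofReal_re] at h'
  rw [← h']
  refine Finset.sum_congr rfl fun Q _ => ?_
  rw [Complex.re_ofReal_mul, mul_comm]
  rfl

/-! ### The mimicking protocol and the adaptive upper bound -/

instance : Nonempty {ρ : Matrix (Qubits n) (Qubits n) ℂ // IsState ρ} :=
  ⟨⟨((2 : ℂ) ^ n)⁻¹ • 1, PosSemidef.one.smul (by positivity), by simp [Matrix.trace_smul]⟩⟩

/-- A state for which the squares of all Pauli expectations are close to the empirical averages,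
if there is one. -/
noncomputable def mimickingState (τ : ℝ) {T : ℕ} (s : Fin T → PauliString n) :
    {ρ : Matrix (Qubits n) (Qubits n) ℂ // IsState ρ} :=
  Classical.epsilon fun ρ => ∀ P : PauliString n,
    |bellAverage s P - (P.toMatrix * ρ.1).trace.re ^ 2| < τ

/-- When the averages are accurate, `σ` itself meets the requirement, so the choice made by
`Classical.epsilon` does too. -/
theorem abs_bellAverage_sub_mimickingState_lt {τ : ℝ} {T : ℕ} {s : Fin T → PauliString n}
    (hσ : IsState σ) (hs : IsAccurate ((bellPOVM n).prob σ) τ s) (P : PauliString n) :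
    |bellAverage s P - (P.toMatrix * (mimickingState τ s).1).trace.re ^ 2| < τ := by
  refine Classical.epsilon_spec (p := fun ρ : {ρ : Matrix (Qubits n) (Qubits n) ℂ // IsState ρ} =>
    ∀ P : PauliString n, |bellAverage s P - (P.toMatrix * ρ.1).trace.re ^ 2| < τ)
    ⟨⟨σ, hσ⟩, fun P => ?_⟩ P
  rw [← sum_bellPOVM_prob hσ]
  exact hs P

/-- The protocol that first estimates the squares of all Pauli expectations of `σ` from Bell
measurements of `σ ⊗ σ`, then finds a state `ρ` that mimics `σ`, and finally estimates all products
of the Pauli expectations of `σ` and `ρ` from Bell measurements of `σ ⊗ ρ`. -/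
noncomputable def mimickingProtocol (n T : ℕ) (τ ε : ℝ) : Protocol n where
  Seed := Unit
  seedDist := PMF.pure ()
  Outcome := PauliString n
  rounds := T + T
  measurement _ t h :=
    if ht : T ≤ t then
      assistedPOVM _ (mimickingState τ fun i : Fin T => h (Fin.castLE ht i)).2
    else bellPOVM n
  estimate _ s P :=
    if ε / 2 ≤
        |(P.toMatrix * (mimickingState τ fun i => s (Fin.castAdd T i)).1).trace.re| then
      bellAverage (fun i => s (Fin.natAdd T i)) P /
        (P.toMatrix * (mimickingState τ fun i => s (Fin.castAdd T i)).1).trace.re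
    else 0

theorem mimickingProtocol_transcriptProb (hσ : IsState σ) {T : ℕ} {τ ε : ℝ} (r : Unit)
    (s s' : Fin T → PauliString n) :
    (mimickingProtocol n T τ ε).transcriptProb σ r (Fin.append s s') =
      ENNReal.ofReal ((∏ t, (bellPOVM n).prob σ (s t)) *
        ∏ t, (assistedPOVM _ (mimickingState τ s).2).prob σ (s' t)) := by
  have h1 (t : Fin T) : (mimickingProtocol n T τ ε).measurement r (Fin.castAdd T t)
      (fun i => Fin.append s s' (Fin.castLE (Fin.castAdd T t).isLt.le i)) = bellPOVM n := by
    simp [mimickingProtocol]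
  have h2 (t : Fin T) : (mimickingProtocol n T τ ε).measurement r (Fin.natAdd T t)
      (fun i => Fin.append s s' (Fin.castLE (Fin.natAdd T t).isLt.le i)) =
      assistedPOVM _ (mimickingState τ s).2 := by
    have h : (fun i : Fin T => Fin.append s s' (Fin.castAdd T i)) = s := by
      funext i
      exact Fin.append_left _ _ _
    simp only [mimickingProtocol, Fin.val_natAdd, Nat.le_add_right, dif_pos]
    exact congrArg (fun s => assistedPOVM _ (mimickingState τ s).2) h
  rw [ENNReal.ofReal_mul (Finset.prod_nonneg fun _ _ => hσ.prob_nonneg _ _),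
    ENNReal.ofReal_prod_of_nonneg fun _ _ => hσ.prob_nonneg _ _,
    ENNReal.ofReal_prod_of_nonneg fun _ _ => hσ.prob_nonneg _ _]
  refine (Fin.prod_univ_add (a := T) (b := T) _).trans ?_
  congr 1
  · refine Finset.prod_congr rfl fun t _ => ?_
    exact congrArg₂ (fun (M : TwoCopyPOVM n (PauliString n)) Q => ENNReal.ofReal (M.prob σ Q))
      (h1 t) (Fin.append_left s s' t)
  · refine Finset.prod_congr rfl fun t _ => ?_
    exact congrArg₂ (fun (M : TwoCopyPOVM n (PauliString n)) Q => ENNReal.ofReal (M.prob σ Q))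
      (h2 t) (Fin.append_right s s' t)

theorem mimickingProtocol_isGood (hσ : IsState σ) {T : ℕ} {τ ε : ℝ} (hε : 0 < ε)
    (hτ : τ ≤ ε ^ 2 / 4) (r : Unit) {s s' : Fin T → PauliString n}
    (hs : IsAccurate ((bellPOVM n).prob σ) τ s)
    (hs' : IsAccurate ((assistedPOVM _ (mimickingState τ s).2).prob σ) τ s') :
    (mimickingProtocol n T τ ε).IsGood σ ε r (Fin.append s s') := by
  intro P
  have h1 := hs P
  have h2 := abs_bellAverage_sub_mimickingState_lt hσ hs P
  have h3 := hs' P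
  rw [sum_bellPOVM_prob hσ] at h1
  rw [sum_assistedPOVM_prob hσ] at h3
  have hest : (mimickingProtocol n T τ ε).estimate r (Fin.append s s') P =
      if ε / 2 ≤ |(P.toMatrix * (mimickingState τ s).1).trace.re| then
        bellAverage s' P / (P.toMatrix * (mimickingState τ s).1).trace.re else 0 := by
    have hl : (fun i : Fin T => Fin.append s s' (Fin.castAdd T i)) = s :=
      funext (Fin.append_left s s')
    have hr : (fun i : Fin T => Fin.append s s' (Fin.natAdd T i)) = s' :=
      funext (Fin.append_right s s')
    change (if ε / 2 ≤ |(P.toMatrix * (mimickingState τ fun i : Fin T =>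
        Fin.append s s' (Fin.castAdd T i)).1).trace.re| then
      bellAverage (fun i : Fin T => Fin.append s s' (Fin.natAdd T i)) P /
        (P.toMatrix * (mimickingState τ fun i : Fin T =>
          Fin.append s s' (Fin.castAdd T i)).1).trace.re else 0) = _
    rw [hl, hr]
  rw [hest, hσ.trace_mul_eq, ← Complex.ofReal_sub, Complex.norm_real, Real.norm_eq_abs]
  generalize (P.toMatrix * (mimickingState τ s).1).trace.re = y at *
  generalize (P.toMatrix * σ).trace.re = x at *
  rw [abs_lt] at h1 h2
  split_ifs with hy
  · have hy0 : 0 < |y| := lt_of_lt_of_le (by positivity) hy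
    have hy1 : y ≠ 0 := abs_pos.mp hy0
    rw [div_sub' hy1, abs_div, div_lt_iff₀ hy0]
    -- The numerator is below `τ ≤ ε²/4`, while `ε|y| ≥ ε²/2`.
    nlinarith
  · rw [zero_sub, abs_neg]
    refine abs_lt_of_sq_lt_sq ?_ hε.le
    have : y ^ 2 ≤ (ε / 2) ^ 2 := by
      rw [← sq_abs y]
      gcongr
      exact (not_le.mp hy).le
    -- Both squares are within `τ` of the same average, so `x² < y² + 2τ ≤ ε²/4 + ε²/2 < ε²`.
    nlinarith [h1.1, h2.2]

theorem mimickingProtocol_solves {T : ℕ} (hT : 0 < T) {τ ε δ : ℝ} (hε : 0 < ε) (hτ0 : 0 ≤ τ)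
    (hτ1 : τ ≤ 1) (hτ : τ ≤ ε ^ 2 / 4)
    (hδ : 4 ^ n * (4 * Real.exp (-(T * (τ ^ 2 / 4)))) ≤ δ) :
    (mimickingProtocol n T τ ε).Solves ε δ := by
  classical
  intro σ hσ
  have hone {Ω : Type} [Fintype Ω] (M : TwoCopyPOVM n Ω) : ∑ ω, M.prob σ ω = 1 :=
    (hasSum_fintype _).unique (hσ.hasSum_prob M)
  have hprod (s s' : Fin T → PauliString n) : 0 ≤ (∏ t, (bellPOVM n).prob σ (s t)) *
      ∏ t, (assistedPOVM _ (mimickingState τ s).2).prob σ (s' t) :=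
    mul_nonneg (Finset.prod_nonneg fun _ _ => hσ.prob_nonneg _ _)
      (Finset.prod_nonneg fun _ _ => hσ.prob_nonneg _ _)
  have hmain := le_sum_isAccurate (T := T) (hσ.prob_nonneg (bellPOVM n)) (hone _)
    (fun s => hσ.prob_nonneg (assistedPOVM _ (mimickingState τ s).2)) (fun s => hone _)
    hτ0 hτ1 hT
  calc ENNReal.ofReal (1 - δ) ≤ ENNReal.ofReal (∑ s : Fin T → PauliString n,
        ∑ s' : Fin T → PauliString n, if IsAccurate ((bellPOVM n).prob σ) τ s ∧
          IsAccurate ((assistedPOVM _ (mimickingState τ s).2).prob σ) τ s' then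
          (∏ t, (bellPOVM n).prob σ (s t)) *
            ∏ t, (assistedPOVM _ (mimickingState τ s).2).prob σ (s' t) else 0) :=
        ENNReal.ofReal_le_ofReal (by linarith)
    _ ≤ ∑' s : Fin T → PauliString n, ∑' s' : Fin T → PauliString n,
        if (mimickingProtocol n T τ ε).IsGood σ ε () (Fin.append s s') then
          (mimickingProtocol n T τ ε).transcriptProb σ () (Fin.append s s') else 0 := by
        simp only [tsum_fintype]
        rw [ENNReal.ofReal_sum_of_nonneg fun s _ => Finset.sum_nonneg fun s' _ => by
          split_ifs <;> [exact hprod s s'; rfl]]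
        refine Finset.sum_le_sum fun s _ => ?_
        rw [ENNReal.ofReal_sum_of_nonneg fun s' _ => by
          split_ifs <;> [exact hprod s s'; rfl]]
        refine Finset.sum_le_sum fun s' _ => ?_
        split_ifs with h hg hg
        · rw [mimickingProtocol_transcriptProb hσ]
        · exact absurd (mimickingProtocol_isGood hσ hε hτ () h.1 h.2) hg
        · simp
        · simp
    _ = ∑' s : Fin (T + T) → PauliString n,
        if (mimickingProtocol n T τ ε).IsGood σ ε () s then
          (mimickingProtocol n T τ ε).transcriptProb σ () s else 0 := by
        rw [← (Fin.appendEquiv (α := PauliString n) T T).tsum_eq, ENNReal.tsum_prod']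
        rfl
    _ ≤ (mimickingProtocol n T τ ε).successProb σ ε := by
        rw [Protocol.successProb]
        refine le_trans (le_of_eq ?_) (ENNReal.le_tsum ())
        change _ = PMF.pure () () * _
        rw [PMF.pure_apply, if_pos rfl, one_mul]
        rfl

theorem exists_solves_copies_le {ε δ : ℝ} (hε : 0 < ε) (hδ : 0 < δ) :
    ∃ C : ℝ, 0 < C ∧ ∀ n : ℕ, 1 ≤ n → ∃ A : Protocol n,
      A.Solves ε δ ∧ (A.copies : ℝ) ≤ C * n := by
  set τ : ℝ := min (ε ^ 2 / 4) 1 with hτ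
  have hτ0 : 0 < τ := lt_min (by positivity) one_pos
  -- Chosen so that `K n` rounds per stage beat both the union bound `4ⁿ` and `4 / δ`. The absolute
  -- value covers `δ > 4`.
  set K : ℝ := (Real.log 4 + |Real.log (4 / δ)|) / (τ ^ 2 / 4) with hK
  have hlog : 0 < Real.log 4 := Real.log_pos (by norm_num)
  have hK0 : 0 < K := by positivity
  -- Two stages with two copies per round give the 4; rounding up costs at most `1 ≤ n`.
  refine ⟨4 * (K + 1), by positivity, fun n hn => ?_⟩
  have hn' : (1 : ℝ) ≤ n := by exact_mod_cast hn
  have hTpos : 0 < ⌈K * n⌉₊ := Nat.ceil_pos.mpr (by positivity)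
  refine ⟨mimickingProtocol n ⌈K * n⌉₊ τ ε, mimickingProtocol_solves hTpos hε hτ0.le
    (min_le_right _ _) (min_le_left _ _) ?_, ?_⟩
  · have h1 : (Real.log 4 + |Real.log (4 / δ)|) * n ≤ ⌈K * n⌉₊ * (τ ^ 2 / 4) := by
      calc _ = K * n * (τ ^ 2 / 4) := by rw [hK]; field_simp
        _ ≤ _ := by gcongr; exact Nat.le_ceil _
    have h2 : n * Real.log 4 + Real.log (4 / δ) ≤ ⌈K * n⌉₊ * (τ ^ 2 / 4) := by
      nlinarith [le_abs_self (Real.log (4 / δ)), abs_nonneg (Real.log (4 / δ))]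
    have h3 : Real.exp (n * Real.log 4 + Real.log (4 / δ)) = 4 ^ n * (4 / δ) := by
      rw [Real.exp_add, Real.exp_nat_mul, Real.exp_log (by norm_num), Real.exp_log (by positivity)]
    have h4 := Real.exp_le_exp.mpr h2
    rw [h3] at h4
    rw [Real.exp_neg, ← mul_assoc, ← div_eq_mul_inv, div_le_iff₀ (Real.exp_pos _)]
    calc _ = δ * (4 ^ n * (4 / δ)) := by field_simp
      _ ≤ _ := by gcongr
  · have h1 := (Nat.ceil_lt_add_one (by positivity : 0 ≤ K * n)).le
    change ((2 * (⌈K * n⌉₊ + ⌈K * n⌉₊) : ℕ) : ℝ) ≤ _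
    push_cast
    linarith

end PauliShadow

theorem theorem1 :
    -- every nonadaptive protocol with error less than `1` needs `Ω(2 ^ (n / 2))` copies
    (∀ δ : ℝ, 0 < δ → δ < 1 / 2 →
      ∃ c : ℝ, 0 < c ∧ ∀ n : ℕ, 1 ≤ n → ∀ A : PauliShadow.Protocol n,
        A.IsNonadaptive → A.Solves 1 δ → c * (2 : ℝ) ^ ((n : ℝ) / 2) ≤ (A.copies : ℝ)) ∧
    -- some adaptive protocol needs only `O(n)` copies, for every constant error
    (∀ ε δ : ℝ, 0 < ε → 0 < δ →
      ∃ C : ℝ, 0 < C ∧ ∀ n : ℕ, 1 ≤ n → ∃ A : PauliShadow.Protocol n,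
        A.Solves ε δ ∧ (A.copies : ℝ) ≤ C * (n : ℝ)) := by
  -- Twice the constant for rounds, since each round consumes two copies.
  refine ⟨fun δ _ hδ => ⟨(1 - 2 * δ) / 4, by linarith, fun n hn A hA h => ?_⟩,
    fun ε δ hε hδ => PauliShadow.exists_solves_copies_le hε hδ⟩
  have hle := A.le_rounds_of_solves hn hA hδ h
  have hpow : (2 : ℝ) ^ ((n : ℝ) / 2) = √(2 ^ n) := by
    rw [Real.sqrt_eq_rpow, ← Real.rpow_natCast, ← Real.rpow_mul (by norm_num)]
    congr 1
    ring
  rw [hpow, PauliShadow.Protocol.copies]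
  push_cast
  linarith
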